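/- Let $n\ge 2$, let $\mathcal N$ be the real vector space of skew-Hermitian matrices $X\in\mathbb C^{n\times n}$, $X^*=-X$, viewed as a real manifold, and let $\mathcal M\subset\mathcal N$ be the set of derogatory skew-Hermitian matrices, i.e. those having an eigenvalue of geometric multiplicity greater than $1$. Then $\dim_{\mathbb R}\mathcal N=n^2$ and $\mathcal M$ has real codimension $3$ in $\mathcal N$, in the following precise sense. Let $\mathcal M_0\subset\mathcal M$ be the set of matrices in $\mathcal M$ with exactly one multiple eigenvalue, that eigenvalue having multiplicity exactly $2$. Then $\mathcal M_0$ is a nonempty embedded smooth submanifold of $\mathcal N$ of real codimension $\dim\mathcal N-\dim\mathcal M_0=3$; it is relatively open and dense in $\mathcal M$; and $\mathcal M\setminus\mathcal M_0$ is a finite (possibly empty) disjoint union of nonempty embedded smooth submanifolds of $\mathcal N$, each of real codimension strictly greater than $3$. -/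

import Mathlib

open scoped ContDiff

-- The Frobenius norm; any norm induces the same topology and the same smooth maps.
attribute [local instance] Matrix.frobeniusNormedAddCommGroup Matrix.frobeniusNormedSpace

/-- The real vector space (hence real manifold) of complex `n × n` matrices `X` with `X* = -X`. -/
noncomputable abbrev SkewHermitian (n : ℕ) : Submodule ℝ (Matrix (Fin n) (Fin n) ℂ) :=
  skewAdjoint.submodule ℝ (Matrix (Fin n) (Fin n) ℂ)

/-- The geometric multiplicity of `μ` as an eigenvalue of `A` (zero if `μ` is no eigenvalue). -/
noncomputable def geomMult {n : ℕ} (A : Matrix (Fin n) (Fin n) ℂ) (μ : ℂ) : ℕ :=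
  Module.finrank ℂ (Module.End.eigenspace (Matrix.toLin' A) μ)

/-- The derogatory skew-Hermitian matrices: some eigenvalue has geometric multiplicity
greater than one. -/
def derogatorySkewHermitian (n : ℕ) : Set (SkewHermitian n) :=
  {A | ∃ μ : ℂ, 1 < geomMult (A : Matrix (Fin n) (Fin n) ℂ) μ}

/-- The skew-Hermitian matrices with exactly one multiple eigenvalue, of multiplicity two. -/
def oneDoubleSkewHermitian (n : ℕ) : Set (SkewHermitian n) :=
  {A | ∃ μ : ℂ, geomMult (A : Matrix (Fin n) (Fin n) ℂ) μ = 2 ∧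
    ∀ ν : ℂ, ν ≠ μ → geomMult (A : Matrix (Fin n) (Fin n) ℂ) ν ≤ 1}

/-- `M` is an embedded smooth submanifold of dimension `d` of the real vector space `E`: around
each of its points there is a smooth chart of `E` (a diffeomorphism between open subsets of `E`)
that carries `M` to a `d`-dimensional linear subspace. -/
def IsSmoothSubmanifold {E : Type*} [NormedAddCommGroup E] [NormedSpace ℝ E]
    (d : ℕ) (M : Set E) : Prop :=
  ∀ x ∈ M, ∃ (φ : OpenPartialHomeomorph E E) (W : Submodule ℝ E),
    x ∈ φ.source ∧ ContDiffOn ℝ ∞ φ φ.source ∧ ContDiffOn ℝ ∞ φ.symm φ.target ∧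
    Module.finrank ℝ W = d ∧ ∀ y ∈ φ.source, (y ∈ M ↔ φ y ∈ W)

/-- `M` is a nonempty embedded smooth submanifold of `E` with `dim E - dim M = c`. -/
def IsSubmanifoldOfCodim {E : Type*} [NormedAddCommGroup E] [NormedSpace ℝ E]
    (c : ℕ) (M : Set E) : Prop :=
  M.Nonempty ∧ ∃ d : ℕ, IsSmoothSubmanifold d M ∧ d + c = Module.finrank ℝ E

/-! Everything is read off from two unitary invariants: the number `k` of distinct eigenvalues and
the sum `q` of the squared multiplicities. Derogatory means `k < n`, exactly one double eigenvalue
means `k = n - 1`, and each nonempty level set of `(k, q)` is a submanifold of codimension `q - k`,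
the sum of `m ^ 2 - 1` over the multiplicities `m`.

Near `x = U D U*`, with `D` diagonal, write a skew-Hermitian `X` as an off-block part `K` plus a
block-diagonal part, the blocks being the eigenspaces of `D`, and send it to `U exp(K) (D + (X - K))
exp(-K) U*`. The derivative at `0` is invertible because `K ↦ K D - D K` multiplies off-block
entries by nonzero eigenvalue differences (`exists_hasFDerivAt_blockParam`). The image of `X` is
unitarily conjugate to `C = D + (X - K)`, which commutes with `D`. If `C` is close to `D`, it has at
least `k` distinct eigenvalues, and exactly `k` only if it is scalar on each block
(`exists_pos_eigenvalueCount_of_commute`). So a chart turns the locus of constant `k` into a linear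
subspace of dimension `n ^ 2 - q + k` (`exists_chart_eigenvalueCount`).

One double eigenvalue gives `q - k = 3`; in general `q - k ≥ 3 (n - k)`, which is at least 6 once `k
≤ n - 2`. Relative openness is lower semicontinuity of `k`; density comes from separating all
eigenvalues except one coinciding pair. -/

/-! ### Smooth charts from local parametrizations -/

/-- The inverse function theorem, giving a smooth chart whose values stay in a prescribed
neighbourhood of the origin. -/
theorem exists_smooth_chart_of_hasFDerivAt_equiv {E : Type*} [NormedAddCommGroup E]
    [NormedSpace ℝ E] [CompleteSpace E] {Φ : E → E} (hΦ : ContDiff ℝ ∞ Φ) {e : E ≃L[ℝ] E} {a : E}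
    (he : HasFDerivAt Φ (e : E →L[ℝ] E) a) {N : Set E} (hN : N ∈ nhds a) :
    ∃ φ : OpenPartialHomeomorph E E, Φ a ∈ φ.source ∧ ContDiffOn ℝ ∞ φ φ.source ∧
      ContDiffOn ℝ ∞ φ.symm φ.target ∧ ∀ y ∈ φ.source, φ y ∈ N ∧ Φ (φ y) = y := by
  have hne : (∞ : WithTop ℕ∞) ≠ 0 := by simp
  have hopen : IsOpen {x | fderiv ℝ Φ x ∈ Set.range ((↑) : (E ≃L[ℝ] E) → E →L[ℝ] E)} :=
    ContinuousLinearEquiv.isOpen.preimage (hΦ.continuous_fderiv hne)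
  -- Smoothness of the inverse is needed on the whole target, so the source is cut down to points
  -- where the derivative is still invertible.
  set V : Set E := {x | fderiv ℝ Φ x ∈ Set.range ((↑) : (E ≃L[ℝ] E) → E →L[ℝ] E)} ∩ interior N
  have hV : IsOpen V := hopen.inter isOpen_interior
  have haV : a ∈ V := ⟨⟨e, he.fderiv.symm⟩, mem_interior_iff_mem_nhds.2 hN⟩
  set ψ : OpenPartialHomeomorph E E :=
    (hΦ.contDiffAt.toOpenPartialHomeomorph Φ he hne).restrOpen V hV with hψ
  have hcoe : (ψ : E → E) = Φ := rfl
  have hsub : ∀ x ∈ ψ.source, x ∈ V := fun x hx => by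
    rw [hψ, OpenPartialHomeomorph.restrOpen_source] at hx
    exact hx.2
  have has : a ∈ ψ.source := by
    rw [hψ, OpenPartialHomeomorph.restrOpen_source]
    exact ⟨hΦ.contDiffAt.mem_toOpenPartialHomeomorph_source he hne, haV⟩
  refine ⟨ψ.symm, ?_, ?_, ?_, ?_⟩
  · exact hcoe ▸ ψ.map_source has
  · intro y hy
    obtain ⟨e', he'⟩ := (hsub _ (ψ.map_target hy)).1
    refine (ψ.contDiffAt_symm (f₀' := e') hy ?_ ?_).contDiffWithinAt
    · rw [he', hcoe]
      exact (hΦ.differentiable hne _).hasFDerivAt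
    · exact hcoe ▸ hΦ.contDiffAt
  · rw [OpenPartialHomeomorph.symm_symm, hcoe]
    exact hΦ.contDiffOn
  · intro y hy
    exact ⟨interior_subset (hsub _ (ψ.map_target hy)).2, hcoe ▸ ψ.right_inv hy⟩

/-! ### Real dimensions of skew-adjoint parts -/

/-- The skew-adjoint part of a star-closed complex subspace is a real form of it. -/
theorem finrank_skewAdjoint_of_star_mem {A : Type*} [AddCommGroup A] [Module ℂ A]
    [Module ℝ A] [IsScalarTower ℝ ℂ A] [StarAddMonoid A] [StarModule ℂ A] [StarModule ℝ A] (V : Submodule ℂ A) [FiniteDimensional ℂ V]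
    (hV : ∀ x ∈ V, star x ∈ V) :
    Module.finrank ℝ ((V.restrictScalars ℝ).comap (skewAdjoint.submodule ℝ A).subtype) =
      Module.finrank ℂ V := by
  set W := (V.restrictScalars ℝ).comap (skewAdjoint.submodule ℝ A).subtype with hW
  let i : W →ₗ[ℝ] A := (skewAdjoint.submodule ℝ A).subtype ∘ₗ W.subtype
  let J : A →ₗ[ℝ] A := (LinearMap.lsmul ℂ A Complex.I).restrictScalars ℝ
  have hi : ∀ x : W, i x ∈ V := fun x => x.2
  have his : ∀ x : W, star (i x) = - i x := fun x => x.1.2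
  -- The map `(x, y) ↦ x + i y` realizes `V = W ⊕ i W`, so the real dimension of `V` is twice that
  -- of `W`.
  let f : W × W →ₗ[ℝ] V.restrictScalars ℝ :=
    (i.coprod (J ∘ₗ i)).codRestrict _ fun x =>
      V.add_mem (hi x.1) (V.smul_mem Complex.I (hi x.2))
  have hf : ∀ x, (f x : A) = i x.1 + Complex.I • i x.2 := fun x => rfl
  have hii : Function.Injective i := Subtype.val_injective.comp Subtype.val_injective
  have h2 : ∀ z : A, z = -z → z = 0 := fun z hz => by
    have h : (2 : ℂ) • z = 0 := by rw [two_smul]; nth_rewrite 1 [hz]; simp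
    simpa using h
  have hinj : Function.Injective f := by
    rw [injective_iff_map_eq_zero]
    rintro ⟨x, y⟩ h
    have h1 : i x + Complex.I • i y = 0 := by rw [← hf (x, y), h]; rfl
    have h3 := congrArg star h1
    simp only [star_add, star_smul, his, star_zero, Complex.star_def, Complex.conj_I] at h3
    have hx : i x = 0 := h2 _ (by
      have e1 : i x = -(Complex.I • i y) := eq_neg_of_add_eq_zero_left h1
      have e2 : -i x + Complex.I • i y = 0 := by simpa using h3
      have e3 : Complex.I • i y = i x := by rwa [neg_add_eq_zero, eq_comm] at e2
      rw [← e3] at e1 ⊢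
      exact e1)
    have hy : i y = 0 := by simpa [hx] using h1
    exact Prod.ext (hii (by simpa using hx)) (hii (by simpa using hy))
  have hsurj : Function.Surjective f := by
    rintro ⟨z, hz⟩
    have hz : z ∈ V := hz
    have hr : star ((2 : ℂ)⁻¹) = 2⁻¹ := by simp
    refine ⟨(⟨⟨(2 : ℂ)⁻¹ • (z - star z), ?_⟩, ?_⟩,
      ⟨⟨(-(2 : ℂ)⁻¹ * Complex.I) • (z + star z), ?_⟩, ?_⟩), ?_⟩
    · show star _ = -_
      rw [star_smul, hr, star_sub, star_star, ← smul_neg, neg_sub]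
    · exact V.smul_mem _ (V.sub_mem hz (hV z hz))
    · show star _ = -_
      rw [star_smul, star_add, star_star, ← neg_smul, add_comm]
      simp
    · exact V.smul_mem _ (V.add_mem hz (hV z hz))
    · apply Subtype.ext
      rw [hf]
      show (2 : ℂ)⁻¹ • (z - star z) + Complex.I • ((-(2 : ℂ)⁻¹ * Complex.I) • (z + star z)) = z
      rw [smul_smul, show Complex.I * (-(2 : ℂ)⁻¹ * Complex.I) = 2⁻¹ by
        linear_combination (-(2 : ℂ)⁻¹) * Complex.I_mul_I, ← smul_add, sub_add_add_cancel,
        ← two_smul ℂ z, smul_smul]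
      simp
  have : IsScalarTower ℝ ℂ (V.restrictScalars ℝ) := ⟨fun r c x => Subtype.ext (smul_assoc r c _)⟩
  have : FiniteDimensional ℂ (V.restrictScalars ℝ) := inferInstanceAs (FiniteDimensional ℂ V)
  have : FiniteDimensional ℝ (V.restrictScalars ℝ) := Module.Finite.trans ℂ _
  have h1 := (LinearEquiv.ofBijective f ⟨hinj, hsurj⟩).finrank_eq
  have : FiniteDimensional ℝ W :=
    Module.Finite.of_injective (f ∘ₗ LinearMap.inl ℝ W W)
      (hinj.comp fun a b h => by simpa using h)
  rw [Module.finrank_prod] at h1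
  have h3 : Module.finrank ℝ (V.restrictScalars ℝ) = 2 * Module.finrank ℂ V := by
    rw [← Complex.finrank_real_complex]
    exact (Module.finrank_mul_finrank ℝ ℂ (V.restrictScalars ℝ)).symm
  omega

theorem finrank_skewHermitian (n : ℕ) : Module.finrank ℝ (SkewHermitian n) = n ^ 2 := by
  have h := finrank_skewAdjoint_of_star_mem (⊤ : Submodule ℂ (Matrix (Fin n) (Fin n) ℂ))
    (fun _ _ => trivial)
  rw [finrank_top, Module.finrank_matrix] at h
  simp only [Fintype.card_fin, Module.finrank_self, mul_one] at h
  rw [sq, ← h]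
  exact (LinearEquiv.ofTop _ (by ext; simp)).finrank_eq.symm

/-! ### Unitary diagonalization and multiplicities -/

theorem geomMult_unitary_conj_diagonal {n : ℕ} {U : Matrix (Fin n) (Fin n) ℂ}
    (hU : U ∈ Matrix.unitaryGroup (Fin n) ℂ) (d : Fin n → ℂ) (μ : ℂ) :
    geomMult (U * Matrix.diagonal d * star U) μ = (Finset.univ.filter fun j => d j = μ).card := by
  set A := U * Matrix.diagonal d * star U
  have hUU : U * star U = 1 := Matrix.mem_unitaryGroup_iff.1 hU
  have hdet : IsUnit U.det := (Matrix.isUnit_iff_isUnit_det U).1 (.of_mul_eq_one _ hUU)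
  have hdet' : IsUnit (star U).det :=
    (Matrix.isUnit_iff_isUnit_det _).1
      (.of_mul_eq_one _ (Matrix.mem_unitaryGroup_iff'.1 hU))
  have hA : A - Matrix.scalar (Fin n) μ =
      U * Matrix.diagonal (fun j => d j - μ) * star U := by
    have : Matrix.diagonal (fun j => d j - μ) = Matrix.diagonal d - μ • (1 : Matrix _ _ ℂ) := by
      rw [Matrix.smul_one_eq_diagonal, Matrix.diagonal_sub]
    rw [this, mul_sub, sub_mul, mul_smul_comm, mul_one, smul_mul_assoc, hUU,
      Matrix.scalar_apply, Matrix.smul_one_eq_diagonal]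
  have hrank : (A - Matrix.scalar (Fin n) μ).rank =
      Fintype.card {j // d j - μ ≠ 0} := by
    rw [hA, Matrix.rank_mul_eq_left_of_isUnit_det _ _ hdet',
      Matrix.rank_mul_eq_right_of_isUnit_det _ _ hdet, Matrix.rank_diagonal]
  have hker := LinearMap.finrank_range_add_finrank_ker
    (Matrix.toLin' (A - Matrix.scalar (Fin n) μ))
  have hE : Module.End.eigenspace (Matrix.toLin' A) μ =
      LinearMap.ker (Matrix.toLin' (A - Matrix.scalar (Fin n) μ)) := by
    ext v
    simp [sub_eq_zero, ← Matrix.smul_one_eq_diagonal]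
  rw [geomMult, hE, Matrix.toLin'_apply']
  rw [Matrix.toLin'_apply', ← Matrix.rank, hrank] at hker
  have hc : Fintype.card {j // d j - μ ≠ 0} = (Finset.univ.filter fun j => ¬ d j = μ).card := by
    rw [Fintype.card_subtype]
    simp only [ne_eq, sub_eq_zero]
  have hs := Finset.card_filter_add_card_filter_not (s := (Finset.univ : Finset (Fin n)))
    (fun j => d j = μ)
  rw [hc, Module.finrank_fin_fun] at hker
  rw [Finset.card_univ, Fintype.card_fin] at hs
  omega

theorem exists_eq_unitary_conj_diagonal_of_skewHermitian {n : ℕ} (A : SkewHermitian n) :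
    ∃ U ∈ Matrix.unitaryGroup (Fin n) ℂ, ∃ l : Fin n → ℝ,
      (A : Matrix (Fin n) (Fin n) ℂ) =
        U * Matrix.diagonal (fun j => (l j : ℂ) * Complex.I) * star U := by
  have hA : star (A : Matrix (Fin n) (Fin n) ℂ) = -A := A.2
  -- Multiplying by `-i` reduces to the Hermitian spectral theorem; multiplying back by `i` makes
  -- the eigenvalues imaginary.
  have hH : (-Complex.I • (A : Matrix (Fin n) (Fin n) ℂ)).IsHermitian := by
    show star _ = _
    rw [star_smul, hA]
    simp
  refine ⟨hH.eigenvectorUnitary, hH.eigenvectorUnitary.2, hH.eigenvalues, ?_⟩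
  have h := hH.spectral_theorem
  rw [Unitary.conjStarAlgAut_apply] at h
  have h2 : (A : Matrix (Fin n) (Fin n) ℂ) = Complex.I • (-Complex.I • (A : Matrix _ _ ℂ)) := by
    rw [smul_smul]; simp
  have h3 : Matrix.diagonal (fun j => (hH.eigenvalues j : ℂ) * Complex.I) =
      Complex.I • Matrix.diagonal (RCLike.ofReal ∘ hH.eigenvalues) := by
    rw [← Matrix.diagonal_smul]
    congr 1
    ext j
    simp [mul_comm]
  rw [h3, mul_smul_comm, smul_mul_assoc]
  conv_lhs => rw [h2, h]

theorem unitary_conj_diagonal_mul_I_mem {n : ℕ} {U : Matrix (Fin n) (Fin n) ℂ}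
    (l : Fin n → ℝ) :
    U * Matrix.diagonal (fun j => (l j : ℂ) * Complex.I) * star U ∈ SkewHermitian n := by
  show star _ = -_
  rw [star_mul, star_mul, star_star, ← mul_assoc, Matrix.star_eq_conjTranspose (Matrix.diagonal _),
    Matrix.diagonal_conjTranspose, ← neg_mul, ← mul_neg, Matrix.diagonal_neg]
  congr 3
  ext j
  simp

/-! ### Counting fibres of the eigenvalue list -/

theorem card_filter_eq_ne_zero_iff {n : ℕ} (d : Fin n → ℂ) (μ : ℂ) :
    (Finset.univ.filter fun j => d j = μ).card ≠ 0 ↔ μ ∈ Finset.univ.image d := by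
  simp [Finset.eq_empty_iff_forall_notMem]

theorem sum_card_filter_eq {n : ℕ} (d : Fin n → ℂ) :
    ∑ μ ∈ Finset.univ.image d, (Finset.univ.filter fun j => d j = μ).card = n := by
  rw [← Finset.card_eq_sum_card_image]
  simp

theorem exists_one_lt_card_filter_iff {n : ℕ} (d : Fin n → ℂ) :
    (∃ μ, 1 < (Finset.univ.filter fun j => d j = μ).card) ↔
      (Finset.univ.image d).card < n := by
  rw [← not_iff_not, not_lt, not_exists]
  have h : (Finset.univ.image d).card ≤ n := by
    simpa using Finset.card_image_le (s := Finset.univ) (f := d)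
  have h2 : (n ≤ (Finset.univ.image d).card) ↔ Function.Injective d := by
    rw [← Set.injOn_univ, ← Finset.coe_univ, ← Finset.card_image_iff, Finset.card_univ,
      Fintype.card_fin]
    omega
  rw [h2]
  constructor
  · intro h a b hab
    exact Finset.card_le_one.1 (not_lt.1 (h (d b))) a (by simpa using hab) b (by simp)
  · intro h μ
    rw [not_lt, Finset.card_le_one]
    intro a ha b hb
    simp only [Finset.mem_filter, Finset.mem_univ, true_and] at ha hb
    exact h (ha.trans hb.symm)

/-- The difference between `n` and the number of values is the sum of the excesses `m - 1` over the
fibres; it is 1 exactly when a single excess is 1 and the others vanish. -/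
theorem exists_unique_double_iff {n : ℕ} (d : Fin n → ℂ) :
    (∃ μ, (Finset.univ.filter fun j => d j = μ).card = 2 ∧
      ∀ ν, ν ≠ μ → (Finset.univ.filter fun j => d j = ν).card ≤ 1) ↔
      (Finset.univ.image d).card + 1 = n := by
  set c : ℂ → ℕ := fun μ => (Finset.univ.filter fun j => d j = μ).card with hc
  have hsum : ∑ μ ∈ Finset.univ.image d, c μ = n := sum_card_filter_eq d
  have hmem : ∀ μ, c μ ≠ 0 ↔ μ ∈ Finset.univ.image d := card_filter_eq_ne_zero_iff d
  set s := Finset.univ.image d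
  constructor
  · rintro ⟨μ, h2, h1⟩
    have hμ : μ ∈ s := (hmem μ).1 (by simp [hc, h2])
    have h3 : ∑ ν ∈ s.erase μ, c ν = ∑ ν ∈ s.erase μ, 1 := Finset.sum_congr rfl fun ν hν => by
      have := (hmem ν).2 (Finset.mem_of_mem_erase hν)
      have := h1 ν (Finset.ne_of_mem_erase hν)
      simp only [hc] at *
      omega
    rw [← Finset.add_sum_erase _ _ hμ, h3, Finset.sum_const, smul_eq_mul, mul_one,
      Finset.card_erase_of_mem hμ] at hsum
    have : 0 < s.card := Finset.card_pos.2 ⟨μ, hμ⟩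
    change c μ = 2 at h2
    omega
  · intro hk
    have hlt : ∃ μ ∈ s, 1 < c μ := by
      by_contra! hcon
      have := Finset.sum_le_card_nsmul s c 1 hcon
      rw [hsum, smul_eq_mul, mul_one] at this
      omega
    obtain ⟨μ, hμ, h1⟩ := hlt
    have hcard : (s.erase μ).card = s.card - 1 := Finset.card_erase_of_mem hμ
    have hpos : 0 < s.card := Finset.card_pos.2 ⟨μ, hμ⟩
    have hge : ∀ t ⊆ s, t.card ≤ ∑ ν ∈ t, c ν := fun t ht => by
      have := Finset.card_nsmul_le_sum t c 1 fun ν hν => Nat.one_le_iff_ne_zero.2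
        ((hmem ν).2 (ht hν))
      simpa using this
    have h4 := hge _ (Finset.erase_subset μ s)
    have h5 := Finset.add_sum_erase s c hμ
    refine ⟨μ, by change c μ = 2; omega, fun ν hν => ?_⟩
    by_contra! h6
    change 1 < c ν at h6
    -- A second fibre of size at least 2 would push the total size to at least `s.card + 2`, which
    -- exceeds `n`.
    have hνs : ν ∈ s.erase μ := Finset.mem_erase.2 ⟨hν, (hmem ν).1 (by omega)⟩
    have h7 := Finset.add_sum_erase _ c hνs
    have h8 := hge _ ((Finset.erase_subset ν _).trans (Finset.erase_subset μ s))
    rw [Finset.card_erase_of_mem hνs] at h8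
    omega

theorem sum_sq_card_filter_eq {n : ℕ} (d : Fin n → ℂ) :
    ∑ μ ∈ Finset.univ.image d, (Finset.univ.filter fun j => d j = μ).card ^ 2 =
      (Finset.univ.filter fun p : Fin n × Fin n => d p.1 = d p.2).card := by
  rw [Finset.card_eq_sum_card_fiberwise (f := fun p : Fin n × Fin n => d p.1)
    (t := Finset.univ.image d) (fun p _ => by simp)]
  refine Finset.sum_congr rfl fun μ _ => ?_
  rw [sq, ← Finset.card_product]
  congr 1
  ext p
  simp only [Finset.mem_product, Finset.mem_filter, Finset.mem_univ, true_and]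
  constructor
  · rintro ⟨h1, h2⟩; exact ⟨h1.trans h2.symm, h1⟩
  · rintro ⟨h1, h2⟩; exact ⟨h2, h1 ▸ h2⟩

/-- Sum `3 m ≤ m ^ 2 + 2`, that is `(m - 1) (m - 2) ≥ 0`, over the fibres. This is the source of the
codimension bound. -/
theorem card_image_add_three_mul_le {n : ℕ} (d : Fin n → ℂ) :
    (Finset.univ.image d).card + 3 * (n - (Finset.univ.image d).card) ≤
      (Finset.univ.filter fun p : Fin n × Fin n => d p.1 = d p.2).card := by
  have hle : (Finset.univ.image d).card ≤ n := by
    simpa using Finset.card_image_le (s := Finset.univ) (f := d)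
  have h : ∑ μ ∈ Finset.univ.image d, 3 * (Finset.univ.filter fun j => d j = μ).card ≤
      ∑ μ ∈ Finset.univ.image d, ((Finset.univ.filter fun j => d j = μ).card ^ 2 + 2) := by
    refine Finset.sum_le_sum fun μ hμ => ?_
    have := (card_filter_eq_ne_zero_iff d μ).2 hμ
    obtain ⟨m, hm⟩ := Nat.exists_eq_succ_of_ne_zero this
    rw [hm]
    rcases m with _ | m
    · simp
    · simp only [Nat.succ_eq_add_one]; nlinarith
  rw [← Finset.mul_sum, sum_card_filter_eq, Finset.sum_add_distrib, sum_sq_card_filter_eq,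
    Finset.sum_const, smul_eq_mul] at h
  omega

theorem card_filter_pairs_of_card_image_succ {n : ℕ} {d : Fin n → ℂ}
    (h : (Finset.univ.image d).card + 1 = n) :
    (Finset.univ.filter fun p : Fin n × Fin n => d p.1 = d p.2).card =
      (Finset.univ.image d).card + 3 := by
  obtain ⟨μ, h2, h1⟩ := (exists_unique_double_iff d).2 h
  have hμ : μ ∈ Finset.univ.image d := (card_filter_eq_ne_zero_iff d μ).1 (by simp [h2])
  rw [← sum_sq_card_filter_eq, ← Finset.add_sum_erase _ _ hμ, h2,
    Finset.sum_congr rfl (g := fun _ => 1), Finset.sum_const, Finset.card_erase_of_mem hμ]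
  · have : 0 < (Finset.univ.image d).card := Finset.card_pos.2 ⟨μ, hμ⟩
    simp only [smul_eq_mul, mul_one]
    omega
  · intro ν hν
    have := (card_filter_eq_ne_zero_iff d ν).2 (Finset.mem_of_mem_erase hν)
    have := h1 ν (Finset.ne_of_mem_erase hν)
    have : (Finset.univ.filter fun j => d j = ν).card = 1 := by omega
    rw [this, one_pow]

/-! ### The two invariants -/

/-- The number of distinct eigenvalues. -/
noncomputable def eigenvalueCount {n : ℕ} (A : Matrix (Fin n) (Fin n) ℂ) : ℕ :=
  {μ | geomMult A μ ≠ 0}.ncard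

/-- The sum of the squares of the geometric multiplicities. -/
noncomputable def sumSqMult {n : ℕ} (A : Matrix (Fin n) (Fin n) ℂ) : ℕ :=
  ∑ᶠ μ, geomMult A μ ^ 2

theorem setOf_geomMult_ne_zero_unitary_conj_diagonal {n : ℕ} {U : Matrix (Fin n) (Fin n) ℂ}
    (hU : U ∈ Matrix.unitaryGroup (Fin n) ℂ) (d : Fin n → ℂ) :
    {μ | geomMult (U * Matrix.diagonal d * star U) μ ≠ 0} =
      (Finset.univ.image d : Set ℂ) := by
  ext μ
  rw [Set.mem_ofPred_eq, geomMult_unitary_conj_diagonal hU, card_filter_eq_ne_zero_iff,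
    Finset.mem_coe]

theorem eigenvalueCount_unitary_conj_diagonal {n : ℕ} {U : Matrix (Fin n) (Fin n) ℂ}
    (hU : U ∈ Matrix.unitaryGroup (Fin n) ℂ) (d : Fin n → ℂ) :
    eigenvalueCount (U * Matrix.diagonal d * star U) = (Finset.univ.image d).card := by
  rw [eigenvalueCount, setOf_geomMult_ne_zero_unitary_conj_diagonal hU, Set.ncard_coe_finset]

theorem sumSqMult_unitary_conj_diagonal {n : ℕ} {U : Matrix (Fin n) (Fin n) ℂ}
    (hU : U ∈ Matrix.unitaryGroup (Fin n) ℂ) (d : Fin n → ℂ) :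
    sumSqMult (U * Matrix.diagonal d * star U) =
      (Finset.univ.filter fun p : Fin n × Fin n => d p.1 = d p.2).card := by
  rw [sumSqMult, finsum_eq_sum_of_support_subset (s := Finset.univ.image d),
    ← sum_sq_card_filter_eq]
  · simp only [geomMult_unitary_conj_diagonal hU]
  · rw [← setOf_geomMult_ne_zero_unitary_conj_diagonal hU]
    intro μ hμ h
    exact hμ (by simp [h])

theorem mem_derogatorySkewHermitian_iff {n : ℕ} (A : SkewHermitian n) :
    A ∈ derogatorySkewHermitian n ↔ eigenvalueCount (A : Matrix (Fin n) (Fin n) ℂ) < n := by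
  obtain ⟨U, hU, l, h⟩ := exists_eq_unitary_conj_diagonal_of_skewHermitian A
  rw [derogatorySkewHermitian, Set.mem_ofPred_eq, h, eigenvalueCount_unitary_conj_diagonal hU,
    ← exists_one_lt_card_filter_iff]
  simp only [geomMult_unitary_conj_diagonal hU]

theorem mem_oneDoubleSkewHermitian_iff {n : ℕ} (A : SkewHermitian n) :
    A ∈ oneDoubleSkewHermitian n ↔ eigenvalueCount (A : Matrix (Fin n) (Fin n) ℂ) + 1 = n := by
  obtain ⟨U, hU, l, h⟩ := exists_eq_unitary_conj_diagonal_of_skewHermitian A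
  rw [oneDoubleSkewHermitian, Set.mem_ofPred_eq, h, eigenvalueCount_unitary_conj_diagonal hU,
    ← exists_unique_double_iff]
  simp only [geomMult_unitary_conj_diagonal hU]

theorem iSup_eigenspace_unitary_conj_diagonal {n : ℕ} {U : Matrix (Fin n) (Fin n) ℂ}
    (hU : U ∈ Matrix.unitaryGroup (Fin n) ℂ) (d : Fin n → ℂ) :
    ⨆ μ, Module.End.eigenspace (Matrix.toLin' (U * Matrix.diagonal d * star U)) μ = ⊤ := by
  rw [eq_top_iff]
  rintro v -
  have hv : v = U.mulVec ((star U).mulVec v) := by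
    rw [Matrix.mulVec_mulVec, Matrix.mem_unitaryGroup_iff.1 hU, Matrix.one_mulVec]
  rw [hv]
  generalize (star U).mulVec v = w
  rw [pi_eq_sum_univ' w, Matrix.mulVec_sum]
  refine Submodule.sum_mem _ fun j _ => ?_
  refine Submodule.mem_iSup_of_mem (d j) ?_
  rw [Module.End.mem_eigenspace_iff, Matrix.toLin'_apply, Matrix.mulVec_mulVec, mul_assoc,
    Matrix.mem_unitaryGroup_iff'.1 hU, mul_one, ← Matrix.mulVec_mulVec, ← Matrix.mulVec_smul]
  congr 1
  ext i
  rw [Matrix.mulVec_diagonal]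
  by_cases h : i = j
  · subst h; simp
  · simp [h]

/-! ### Perturbations commuting with a diagonal matrix -/

section
attribute [local instance] Matrix.frobeniusNormedRing Matrix.frobeniusNormedAlgebra

/-- The difference `μ - δ` is an eigenvalue of `C - D`. The factor `‖1‖` appears because the
Frobenius norm of the identity need not be 1. -/
theorem norm_sub_le_of_common_eigenvector {n : ℕ} {C D : Matrix (Fin n) (Fin n) ℂ} {μ δ : ℂ}
    {w : Fin n → ℂ} (hw : w ≠ 0) (hC : C.mulVec w = μ • w) (hD : D.mulVec w = δ • w) :
    ‖μ - δ‖ ≤ ‖C - D‖ * ‖(1 : Matrix (Fin n) (Fin n) ℂ)‖ := by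
  have h : Module.End.HasEigenvalue (Matrix.toLin' (C - D)) (μ - δ) :=
    Module.End.hasEigenvalue_of_hasEigenvector (x := w) ⟨by
      rw [Module.End.mem_eigenspace_iff, Matrix.toLin'_apply, Matrix.sub_mulVec, hC, hD,
        sub_smul], hw⟩
  have h2 := h.mem_spectrum
  rw [Matrix.spectrum_toLin'] at h2
  exact spectrum.norm_le_norm_mul_of_mem h2

/-- A diagonalizable matrix commuting with, and close to, a diagonal matrix has at least as many
distinct eigenvalues; if it has equally many, it is a function of the diagonal matrix. -/
theorem exists_pos_eigenvalueCount_of_commute {n : ℕ} (d : Fin n → ℂ) :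
    ∃ ε > 0, ∀ C : Matrix (Fin n) (Fin n) ℂ, ‖C - Matrix.diagonal d‖ < ε →
      Commute C (Matrix.diagonal d) →
      ⨆ μ, Module.End.eigenspace (Matrix.toLin' C) μ = ⊤ →
      {μ | geomMult C μ ≠ 0}.Finite →
      (Finset.univ.image d).card ≤ eigenvalueCount C ∧
      (eigenvalueCount C = (Finset.univ.image d).card →
        ∃ g : ℂ → ℂ, C = Matrix.diagonal (g ∘ d)) := by
  -- With `r` at most half the smallest gap, a number can lie within `r` of at most one eigenvalue
  -- of `D`.
  obtain ⟨r, hr, hgap⟩ : ∃ r > 0, ∀ a b, d a ≠ d b → 2 * r ≤ ‖d a - d b‖ := by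
    have hfin : (Set.univ : Set (Fin n × Fin n)).Finite := Set.finite_univ
    have hev : ∀ᶠ r : ℝ in nhdsWithin 0 (Set.Ioi 0),
        ∀ p ∈ (Set.univ : Set (Fin n × Fin n)), d p.1 ≠ d p.2 → 2 * r ≤ ‖d p.1 - d p.2‖ := by
      rw [Filter.eventually_all_finite hfin]
      rintro p -
      by_cases hp : d p.1 = d p.2
      · simp [hp]
      · have h0 : 0 < ‖d p.1 - d p.2‖ / 2 := by
          have := norm_pos_iff.2 (sub_ne_zero.2 hp); positivity
        filter_upwards [nhdsWithin_le_nhds (Iio_mem_nhds h0)] with r hr _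
        rw [Set.mem_Iio] at hr
        linarith
    obtain ⟨r, h1, h2⟩ := (hev.and self_mem_nhdsWithin).exists
    exact ⟨r, h2, fun a b => h1 (a, b) trivial⟩
  set K := ‖(1 : Matrix (Fin n) (Fin n) ℂ)‖
  have hK : 0 ≤ K := norm_nonneg _
  refine ⟨r / (K + 1), by positivity, fun C hC hcomm htop hfin => ?_⟩
  set D := Matrix.diagonal d with hD
  have hclose : ∀ μ δ (w : Fin n → ℂ), w ≠ 0 → C.mulVec w = μ • w → D.mulVec w = δ • w →
      ‖μ - δ‖ < r := fun μ δ w hw h1 h2 => by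
    have h3 := norm_sub_le_of_common_eigenvector hw h1 h2
    rw [lt_div_iff₀ (by positivity)] at hC
    nlinarith [norm_nonneg (C - D)]
  -- Since `C` commutes with `D`, it preserves each eigenspace of `D`; being diagonalizable, it
  -- splits that space into joint eigenspaces.
  have hdec : ∀ δ, Module.End.eigenspace (Matrix.toLin' D) δ =
      ⨆ μ, Module.End.eigenspace (Matrix.toLin' D) δ ⊓
        Module.End.eigenspace (Matrix.toLin' C) μ := fun δ => by
    have h := Submodule.inf_iSup_genEigenspace (f := Matrix.toLin' C)
      (p := Module.End.eigenspace (Matrix.toLin' D) δ) (fun w hw => by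
        rw [Module.End.mem_eigenspace_iff, Matrix.toLin'_apply] at hw ⊢
        rw [Matrix.toLin'_apply, Matrix.mulVec_mulVec, ← hcomm.eq, ← Matrix.mulVec_mulVec, hw,
          Matrix.mulVec_smul]) 1
    have htop' : ⨆ μ, Module.End.genEigenspace (Matrix.toLin' C) μ 1 = ⊤ := htop
    rw [htop', inf_top_eq] at h
    exact h
  have hsingle : ∀ j, Pi.single j 1 ∈ Module.End.eigenspace (Matrix.toLin' D) (d j) := fun j => by
    rw [Module.End.mem_eigenspace_iff, Matrix.toLin'_apply, hD, Matrix.diagonal_mulVec_single]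
    ext i
    by_cases h : i = j
    · subst h; simp
    · simp [h]
  have hex : ∀ δ ∈ Finset.univ.image d, ∃ μ, geomMult C μ ≠ 0 ∧ ‖μ - δ‖ < r := by
    intro δ hδ
    obtain ⟨j, -, rfl⟩ := Finset.mem_image.1 hδ
    have hne : (⨆ μ, Module.End.eigenspace (Matrix.toLin' D) (d j) ⊓
        Module.End.eigenspace (Matrix.toLin' C) μ) ≠ ⊥ := by
      rw [← hdec]
      exact Submodule.ne_bot_iff _ |>.2 ⟨_, hsingle j, by simp⟩
    rw [Ne, iSup_eq_bot, not_forall] at hne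
    obtain ⟨μ, hμ⟩ := hne
    obtain ⟨w, ⟨hw1, hw2⟩, hw0⟩ := Submodule.ne_bot_iff _ |>.1 hμ
    refine ⟨μ, ?_, hclose μ _ w hw0 (by simpa [Module.End.mem_eigenspace_iff] using hw2)
      (by simpa [Module.End.mem_eigenspace_iff] using hw1)⟩
    rw [geomMult, Ne, Submodule.finrank_eq_zero]
    exact Submodule.ne_bot_iff _ |>.2 ⟨w, hw2, hw0⟩
  choose! f hf1 hf2 using hex
  have huniq : ∀ δ ∈ Finset.univ.image d, ∀ δ' ∈ Finset.univ.image d,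
      ‖f δ - δ'‖ < r → δ = δ' := by
    intro δ hδ δ' hδ' h
    have h2 := hf2 δ hδ
    obtain ⟨a, -, rfl⟩ := Finset.mem_image.1 hδ
    obtain ⟨b, -, rfl⟩ := Finset.mem_image.1 hδ'
    by_contra hne
    have h3 := hgap a b hne
    have h4 := norm_sub_le_norm_sub_add_norm_sub (d a) (f (d a)) (d b)
    have h5 := norm_sub_rev (d a) (f (d a))
    linarith
  have hinj : Set.InjOn f (Finset.univ.image d : Set ℂ) := fun δ hδ δ' hδ' h =>
    huniq δ hδ δ' hδ' (h ▸ hf2 δ' hδ')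
  have hmaps : f '' (Finset.univ.image d : Set ℂ) ⊆ {μ | geomMult C μ ≠ 0} := by
    rintro _ ⟨δ, hδ, rfl⟩
    exact hf1 δ hδ
  have hcard : (f '' (Finset.univ.image d : Set ℂ)).ncard = (Finset.univ.image d).card := by
    rw [hinj.ncard_image, Set.ncard_coe_finset]
  refine ⟨hcard ▸ Set.ncard_le_ncard hmaps hfin, fun heq => ⟨f, ?_⟩⟩
  -- Equal counts make `f` onto the spectrum of `C`, so only the eigenvalue `f δ` can occur on the
  -- `δ`-eigenspace of `D`.
  have himg := Set.eq_of_subset_of_ncard_le hmaps (by rw [hcard]; exact heq.le) hfin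
  have heig : ∀ j, Module.End.eigenspace (Matrix.toLin' D) (d j) ≤
      Module.End.eigenspace (Matrix.toLin' C) (f (d j)) := by
    intro j
    rw [hdec]
    refine iSup_le fun μ w hw => ?_
    by_cases hw0 : w = 0
    · rw [hw0]; exact Submodule.zero_mem _
    have hμ : μ ∈ {μ | geomMult C μ ≠ 0} := by
      rw [Set.mem_ofPred_eq, geomMult, Ne, Submodule.finrank_eq_zero]
      exact Submodule.ne_bot_iff _ |>.2 ⟨w, hw.2, hw0⟩
    rw [← himg] at hμ
    obtain ⟨δ, hδ, rfl⟩ := hμ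
    have h1 := hclose _ _ w hw0 (by simpa [Module.End.mem_eigenspace_iff] using hw.2)
      (by simpa [Module.End.mem_eigenspace_iff] using hw.1)
    rw [← huniq δ hδ (d j) (by simp) h1]
    exact hw.2
  ext i j
  have h := heig j (hsingle j)
  rw [Module.End.mem_eigenspace_iff, Matrix.toLin'_apply] at h
  have h2 := congrFun h i
  rw [Matrix.mulVec_single_one] at h2
  by_cases hij : i = j
  · subst hij; simpa using h2
  · simpa [hij] using h2
end

/-! ### Block-scalar matrices and the off-block projection -/

/-- The complex matrices whose diagonal blocks, with respect to the partition of the indices into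
the fibres of `d`, are scalar. -/
def scalarBlockSubmodule {n : ℕ} (d : Fin n → ℂ) :
    Submodule ℂ (Matrix (Fin n) (Fin n) ℂ) where
  carrier := {X | (∀ a b, a ≠ b → d a = d b → X a b = 0) ∧ ∀ a b, d a = d b → X a a = X b b}
  add_mem' {X Y} hX hY := ⟨fun a b h h' => by simp [hX.1 a b h h', hY.1 a b h h'],
    fun a b h => by simp [hX.2 a b h, hY.2 a b h]⟩
  zero_mem' := ⟨fun _ _ _ _ => rfl, fun _ _ _ => rfl⟩
  smul_mem' c X hX := ⟨fun a b h h' => by simp [hX.1 a b h h'],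
    fun a b h => by simp [hX.2 a b h]⟩

/-- Free coordinates are the off-block entries and one scalar for each fibre. -/
theorem finrank_scalarBlockSubmodule {n : ℕ} (d : Fin n → ℂ) :
    Module.finrank ℂ (scalarBlockSubmodule d) +
      (Finset.univ.filter fun p : Fin n × Fin n => d p.1 = d p.2).card =
      n ^ 2 + (Finset.univ.image d).card := by
  have hd : ∀ a, d a ∈ Finset.univ.image d := fun a => Finset.mem_image_of_mem d (Finset.mem_univ a)
  let L : ({p : Fin n × Fin n // ¬ d p.1 = d p.2} → ℂ) × (Finset.univ.image d → ℂ) →ₗ[ℂ]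
      scalarBlockSubmodule d :=
    { toFun := fun x => ⟨Matrix.of fun a b =>
          if h : d a = d b then (if a = b then x.2 ⟨d a, hd a⟩ else 0) else x.1 ⟨(a, b), h⟩,
        fun a b h h' => by simp [h, h'], fun a b h => by simp [h]⟩
      map_add' := fun x y => by
        ext a b
        by_cases h : d a = d b <;> by_cases h' : a = b <;> simp [h, h']
      map_smul' := fun c x => by
        ext a b
        by_cases h : d a = d b <;> by_cases h' : a = b <;> simp [h, h'] }
  have hL : ∀ x a b, (L x : Matrix (Fin n) (Fin n) ℂ) a b =
      if h : d a = d b then (if a = b then x.2 ⟨d a, hd a⟩ else 0) else x.1 ⟨(a, b), h⟩ :=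
    fun _ _ _ => rfl
  have hinj : Function.Injective L := by
    rw [injective_iff_map_eq_zero]
    rintro ⟨f, g⟩ h
    have h0 : ∀ a b, (L (f, g) : Matrix (Fin n) (Fin n) ℂ) a b = 0 := fun a b => by rw [h]; rfl
    refine Prod.ext (funext fun ⟨⟨a, b⟩, hab⟩ => ?_) (funext fun ⟨δ, hδ⟩ => ?_)
    · simpa [hL, hab] using h0 a b
    · obtain ⟨a, -, rfl⟩ := Finset.mem_image.1 hδ
      simpa [hL] using h0 a a
  have hsurj : Function.Surjective L := by
    rintro ⟨X, hX⟩
    have hc : ∀ δ : Finset.univ.image d, ∃ a, d a = δ := fun δ => by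
      obtain ⟨a, -, h⟩ := Finset.mem_image.1 δ.2
      exact ⟨a, h⟩
    choose s hs using hc
    refine ⟨(fun p => X p.1.1 p.1.2, fun δ => X (s δ) (s δ)), ?_⟩
    ext a b
    rw [hL]
    by_cases h : d a = d b
    · by_cases h' : a = b
      · subst h'
        simpa using hX.2 _ _ (hs _)
      · simpa [h, h'] using (hX.1 a b h' h).symm
    · simp [h]
  rw [← (LinearEquiv.ofBijective L ⟨hinj, hsurj⟩).finrank_eq, Module.finrank_prod,
    Module.finrank_fintype_fun_eq_card, Module.finrank_fintype_fun_eq_card, Fintype.card_coe,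
    Fintype.card_subtype]
  have h := Finset.card_filter_add_card_filter_not (s := (Finset.univ : Finset (Fin n × Fin n)))
    (fun p => d p.1 = d p.2)
  rw [Finset.card_univ, Fintype.card_prod, Fintype.card_fin, ← sq] at h
  omega

/-- The projection of a skew-Hermitian matrix to its off-diagonal blocks, with respect to the
partition of the indices into the fibres of `d`. -/
noncomputable def offBlock {n : ℕ} (d : Fin n → ℂ) : SkewHermitian n →ₗ[ℝ] SkewHermitian n where
  toFun X := ⟨Matrix.of fun a b => if d a = d b then 0 else (X : Matrix (Fin n) (Fin n) ℂ) a b, by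
    show star _ = -_
    ext a b
    have h : star (X : Matrix (Fin n) (Fin n) ℂ) a b = -(X : Matrix (Fin n) (Fin n) ℂ) a b :=
      congrFun (congrFun X.2 a) b
    rw [Matrix.star_apply] at h ⊢
    by_cases hab : d a = d b
    · simp [hab]
    · simpa [hab, Ne.symm hab] using h⟩
  map_add' X Y := by
    ext a b
    by_cases h : d a = d b <;> simp [h]
  map_smul' c X := by
    ext a b
    by_cases h : d a = d b <;> simp [h]

theorem offBlock_apply {n : ℕ} (d : Fin n → ℂ) (X : SkewHermitian n) (a b : Fin n) :
    (offBlock d X : Matrix (Fin n) (Fin n) ℂ) a b =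
      if d a = d b then 0 else (X : Matrix (Fin n) (Fin n) ℂ) a b := rfl

theorem commute_sub_offBlock_diagonal {n : ℕ} (d : Fin n → ℂ) (X : SkewHermitian n) :
    Commute ((X : Matrix (Fin n) (Fin n) ℂ) - offBlock d X) (Matrix.diagonal d) := by
  ext a b
  rw [Matrix.mul_diagonal, Matrix.diagonal_mul, Matrix.sub_apply, offBlock_apply]
  by_cases h : d a = d b
  · rw [h, mul_comm]
  · simp [h]

theorem mem_scalarBlockSubmodule_iff {n : ℕ} (d : Fin n → ℂ) (X : SkewHermitian n) :
    (X : Matrix (Fin n) (Fin n) ℂ) ∈ scalarBlockSubmodule d ↔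
      ∃ g : ℂ → ℂ, Matrix.diagonal d + ((X : Matrix (Fin n) (Fin n) ℂ) - offBlock d X) =
        Matrix.diagonal (g ∘ d) := by
  constructor
  · rintro ⟨h1, h2⟩
    have hg : ∃ g : ℂ → ℂ, ∀ a, g (d a) = (X : Matrix (Fin n) (Fin n) ℂ) a a := by
      have : Function.FactorsThrough (fun a => (X : Matrix (Fin n) (Fin n) ℂ) a a) d :=
        fun a b h => h2 a b h
      exact ⟨Function.extend d (fun a => (X : Matrix (Fin n) (Fin n) ℂ) a a) 0,
        fun a => this.extend_apply 0 a⟩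
    obtain ⟨g, hg⟩ := hg
    refine ⟨fun δ => δ + g δ, ?_⟩
    ext a b
    rw [Matrix.add_apply, Matrix.sub_apply, offBlock_apply]
    by_cases hab : a = b
    · subst hab; simp [hg]
    · by_cases h : d a = d b
      · simp [hab, h, h1 a b hab h]
      · simp [hab, h]
  · rintro ⟨g, hg⟩
    have h : ∀ a b, d a = d b → Matrix.diagonal d a b + (X : Matrix (Fin n) (Fin n) ℂ) a b =
        Matrix.diagonal (g ∘ d) a b := fun a b hab => by
      rw [← hg, Matrix.add_apply, Matrix.sub_apply, offBlock_apply, if_pos hab, sub_zero]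
    refine ⟨fun a b hab hd => by simpa [hab] using h a b hd, fun a b hd => ?_⟩
    have ha := h a a rfl
    have hb := h b b rfl
    simp only [Matrix.diagonal_apply_eq, Function.comp_apply] at ha hb
    rw [hd, ← hb] at ha
    exact add_left_cancel ha

/-! ### The local parametrization -/

/-- Conjugation by a unitary matrix changes neither of the two invariants. -/
theorem eigenvalueCount_sumSqMult_unitary_conj {n : ℕ} {U : Matrix (Fin n) (Fin n) ℂ}
    (hU : U ∈ Matrix.unitaryGroup (Fin n) ℂ) (A : SkewHermitian n) :
    eigenvalueCount (U * (A : Matrix (Fin n) (Fin n) ℂ) * star U) =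
        eigenvalueCount (A : Matrix (Fin n) (Fin n) ℂ) ∧
      sumSqMult (U * (A : Matrix (Fin n) (Fin n) ℂ) * star U) =
        sumSqMult (A : Matrix (Fin n) (Fin n) ℂ) := by
  obtain ⟨V, hV, l, h⟩ := exists_eq_unitary_conj_diagonal_of_skewHermitian A
  rw [h]
  have : U * (V * Matrix.diagonal (fun j => (l j : ℂ) * Complex.I) * star V) * star U =
      (U * V) * Matrix.diagonal (fun j => (l j : ℂ) * Complex.I) * star (U * V) := by
    simp only [star_mul, mul_assoc]
  rw [this, eigenvalueCount_unitary_conj_diagonal hV, sumSqMult_unitary_conj_diagonal hV,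
    eigenvalueCount_unitary_conj_diagonal (mul_mem hU hV),
    sumSqMult_unitary_conj_diagonal (mul_mem hU hV)]
  exact ⟨rfl, rfl⟩

/-- The skew-Hermitian part of a matrix, after conjugation by `U`. -/
noncomputable def conjSkewPart {n : ℕ} (U : Matrix (Fin n) (Fin n) ℂ) :
    Matrix (Fin n) (Fin n) ℂ →ₗ[ℝ] SkewHermitian n where
  toFun Z := ⟨skewAdjointPart ℝ (U * Z * star U), (skewAdjointPart ℝ (U * Z * star U)).2⟩
  map_add' X Y := by
    apply Subtype.ext
    simp [mul_add, add_mul]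
  map_smul' c X := by
    apply Subtype.ext
    simp

/-- On skew-Hermitian input the projection does nothing; it only makes conjugation a linear map
defined on all matrices with values in `SkewHermitian n`. -/
theorem coe_conjSkewPart_of_mem {n : ℕ} (U : Matrix (Fin n) (Fin n) ℂ)
    {Z : Matrix (Fin n) (Fin n) ℂ} (hZ : star Z = -Z) :
    (conjSkewPart U Z : Matrix (Fin n) (Fin n) ℂ) = U * Z * star U := by
  have h : star (U * Z * star U) = -(U * Z * star U) := by
    rw [star_mul, star_mul, star_star, hZ, ← mul_assoc]; simp
  show ((skewAdjointPart ℝ (U * Z * star U) : skewAdjoint _) : Matrix (Fin n) (Fin n) ℂ) = _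
  rw [skewAdjointPart_apply_coe, h, sub_neg_eq_add, ← two_smul ℝ, smul_smul]
  simp

/-- The parametrization by block-diagonal and block-off-diagonal parts around the skew-Hermitian
matrix `U * diagonal d * star U`. -/
noncomputable def blockParam {n : ℕ} (U : Matrix (Fin n) (Fin n) ℂ) (d : Fin n → ℂ)
    (X : SkewHermitian n) : SkewHermitian n :=
  conjSkewPart U (NormedSpace.exp (offBlock d X : Matrix (Fin n) (Fin n) ℂ) *
    (Matrix.diagonal d + ((X : Matrix (Fin n) (Fin n) ℂ) - offBlock d X)) *
    NormedSpace.exp (-(offBlock d X : Matrix (Fin n) (Fin n) ℂ)))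

theorem exists_unitary_coe_blockParam {n : ℕ} {U : Matrix (Fin n) (Fin n) ℂ}
    (hU : U ∈ Matrix.unitaryGroup (Fin n) ℂ) {d : Fin n → ℂ}
    (hd : Matrix.diagonal d ∈ SkewHermitian n) (X : SkewHermitian n) :
    ∃ G ∈ Matrix.unitaryGroup (Fin n) ℂ, (blockParam U d X : Matrix (Fin n) (Fin n) ℂ) =
      G * (Matrix.diagonal d + ((X : Matrix (Fin n) (Fin n) ℂ) - offBlock d X)) * star G := by
  set K := (offBlock d X).1
  have hK : star K = -K := (offBlock d X).2
  set B := Matrix.diagonal d + ((X : Matrix (Fin n) (Fin n) ℂ) - K)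
  have hBs : star B = -B :=
    (SkewHermitian n).add_mem hd ((SkewHermitian n).sub_mem X.2 (offBlock d X).2)
  have he : star (NormedSpace.exp K) = NormedSpace.exp (-K) := by
    rw [← hK, Matrix.star_eq_conjTranspose, Matrix.star_eq_conjTranspose, Matrix.exp_conjTranspose]
  have he' : star (NormedSpace.exp (-K)) = NormedSpace.exp K := by rw [← he, star_star]
  have hu : NormedSpace.exp K ∈ Matrix.unitaryGroup (Fin n) ℂ := by
    rw [Matrix.mem_unitaryGroup_iff, he, ← Matrix.exp_add_of_commute _ _ (Commute.refl K).neg_right,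
      add_neg_cancel, NormedSpace.exp_zero]
  refine ⟨U * NormedSpace.exp K, mul_mem hU hu, ?_⟩
  rw [blockParam, coe_conjSkewPart_of_mem]
  · simp only [star_mul, he, mul_assoc]
    rfl
  · change star (NormedSpace.exp K * B * NormedSpace.exp (-K)) = -(_ * B * _)
    rw [star_mul, star_mul, he, he', hBs, ← mul_assoc, mul_neg, neg_mul]

section
attribute [local instance] Matrix.frobeniusNormedRing Matrix.frobeniusNormedAlgebra

theorem contDiff_matrix_exp (n : ℕ) :
    ContDiff ℝ ∞ (NormedSpace.exp : Matrix (Fin n) (Fin n) ℂ → Matrix (Fin n) (Fin n) ℂ) := by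
  have : CompleteSpace (Matrix (Fin n) (Fin n) ℂ) := FiniteDimensional.complete ℝ _
  exact contDiff_iff_contDiffAt.2 fun X => (NormedSpace.exp_analytic (𝕂 := ℝ) X).contDiffAt

theorem contDiff_blockParam {n : ℕ} (U : Matrix (Fin n) (Fin n) ℂ) (d : Fin n → ℂ) :
    ContDiff ℝ ∞ (blockParam U d) := by
  have hK : ContDiff ℝ ∞ fun X => (offBlock d X : Matrix (Fin n) (Fin n) ℂ) :=
    ((SkewHermitian n).subtypeL ∘L (offBlock d).toContinuousLinearMap).contDiff
  have hX : ContDiff ℝ ∞ fun X : SkewHermitian n => (X : Matrix (Fin n) (Fin n) ℂ) :=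
    (SkewHermitian n).subtypeL.contDiff
  refine (conjSkewPart U).toContinuousLinearMap.contDiff.comp ?_
  exact (((contDiff_matrix_exp n).comp hK).mul (contDiff_const.add (hX.sub hK))).mul
    ((contDiff_matrix_exp n).comp hK.neg)

theorem exists_hasFDerivAt_blockParam {n : ℕ} {U : Matrix (Fin n) (Fin n) ℂ}
    (hU : U ∈ Matrix.unitaryGroup (Fin n) ℂ) {d : Fin n → ℂ}
    (hd : Matrix.diagonal d ∈ SkewHermitian n) :
    ∃ e : SkewHermitian n ≃L[ℝ] SkewHermitian n,
      HasFDerivAt (blockParam U d) (e : SkewHermitian n →L[ℝ] SkewHermitian n) 0 := by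
  have : CompleteSpace (Matrix (Fin n) (Fin n) ℂ) := FiniteDimensional.complete ℝ _
  set ι := (SkewHermitian n).subtypeL
  set p := ι ∘L (offBlock d).toContinuousLinearMap
  have hexp : HasFDerivAt (NormedSpace.exp : Matrix (Fin n) (Fin n) ℂ → _)
      (1 : Matrix (Fin n) (Fin n) ℂ →L[ℝ] Matrix (Fin n) (Fin n) ℂ) 0 := hasFDerivAt_exp_zero
  have h1 : HasFDerivAt (fun X => NormedSpace.exp (p X)) p 0 :=
    (HasFDerivAt.comp (g := NormedSpace.exp) (g' := 1) (f := p) (f' := p) (0 : SkewHermitian n)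
      (by rw [map_zero]; exact hexp) p.hasFDerivAt).congr_fderiv (by ext; rfl)
  have h3 : HasFDerivAt (fun X => NormedSpace.exp (-(p X))) (-p) 0 :=
    (HasFDerivAt.comp (g := NormedSpace.exp) (g' := 1) (f := fun X => -(p X)) (f' := -p)
      (0 : SkewHermitian n) (by rw [map_zero, neg_zero]; exact hexp)
      p.hasFDerivAt.neg).congr_fderiv (by ext; rfl)
  have h2 : HasFDerivAt (fun X => Matrix.diagonal d + (ι X - p X)) (ι - p) 0 :=
    (ι.hasFDerivAt.sub p.hasFDerivAt).const_add _
  let F : SkewHermitian n →L[ℝ] Matrix (Fin n) (Fin n) ℂ := LinearMap.toContinuousLinearMap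
    { toFun := fun H => ((H : Matrix (Fin n) (Fin n) ℂ) - offBlock d H) +
        ((offBlock d H : Matrix (Fin n) (Fin n) ℂ) * Matrix.diagonal d -
          Matrix.diagonal d * (offBlock d H : Matrix (Fin n) (Fin n) ℂ))
      map_add' := fun X Y => by
        simp only [map_add, Submodule.coe_add, add_mul, mul_add]
        abel
      map_smul' := fun c X => by
        simp only [map_smul, Submodule.coe_smul, smul_mul_assoc, mul_smul_comm, smul_sub, smul_add,
          RingHom.id_apply] }
  have hF : HasFDerivAt (fun X => NormedSpace.exp (p X) * (Matrix.diagonal d + (ι X - p X)) *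
      NormedSpace.exp (-(p X))) F 0 := by
    refine ((h1.mul' h2).mul' h3).congr_fderiv (ContinuousLinearMap.ext fun H => ?_)
    change NormedSpace.exp (p 0) * (Matrix.diagonal d + (ι 0 - p 0)) * (-(p H)) +
      (NormedSpace.exp (p 0) * (ι H - p H) + p H * (Matrix.diagonal d + (ι 0 - p 0))) *
        NormedSpace.exp (-(p 0)) =
      (ι H - p H) + (p H * Matrix.diagonal d - Matrix.diagonal d * p H)
    rw [map_zero, map_zero, neg_zero, NormedSpace.exp_zero]
    noncomm_ring
  let T : SkewHermitian n →L[ℝ] SkewHermitian n := (conjSkewPart U).toContinuousLinearMap ∘L F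
  have hT : HasFDerivAt (blockParam U d) T 0 :=
    (conjSkewPart U).toContinuousLinearMap.hasFDerivAt.comp (0 : SkewHermitian n) hF
  have hTv : ∀ H : SkewHermitian n, T H = conjSkewPart U
      (((H : Matrix (Fin n) (Fin n) ℂ) - offBlock d H) +
        ((offBlock d H : Matrix (Fin n) (Fin n) ℂ) * Matrix.diagonal d -
          Matrix.diagonal d * (offBlock d H : Matrix (Fin n) (Fin n) ℂ))) := fun H => rfl
  -- Inside a block the derivative returns the entry of `H` itself; off the blocks it gives `(d b -
  -- d a)` times that entry. In finite dimension injectivity suffices.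
  have hinj : Function.Injective T := by
    rw [injective_iff_map_eq_zero]
    intro H hH
    rw [hTv] at hH
    have h := congrArg (Subtype.val) hH
    have hs : star (offBlock d H : Matrix (Fin n) (Fin n) ℂ) = -offBlock d H := (offBlock d H).2
    have hH' : star (H : Matrix (Fin n) (Fin n) ℂ) = -H := H.2
    have hd' : star (Matrix.diagonal d) = -Matrix.diagonal d := hd
    rw [coe_conjSkewPart_of_mem _ (by
      rw [star_add, star_sub, star_sub, star_mul, star_mul, hs, hH', hd']
      noncomm_ring)] at h
    have hz : ∀ Z : Matrix (Fin n) (Fin n) ℂ, U * Z * star U = 0 → Z = 0 := fun Z hZ => by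
      have hUU := Matrix.mem_unitaryGroup_iff'.1 hU
      have : star U * (U * Z * star U) * U = Z := by
        rw [← mul_assoc, ← mul_assoc, hUU, one_mul, mul_assoc, hUU, mul_one]
      rw [← this, hZ, mul_zero, zero_mul]
    have h0 := hz _ h
    ext a b
    have hab := congrFun (congrFun h0 a) b
    rw [Matrix.add_apply, Matrix.sub_apply, Matrix.sub_apply, Matrix.mul_diagonal,
      Matrix.diagonal_mul, offBlock_apply] at hab
    by_cases hdd : d a = d b
    · simpa [hdd] using hab
    · simp only [hdd, if_false, sub_self, zero_add, Matrix.zero_apply] at hab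
      have : (d b - d a) * (H : Matrix (Fin n) (Fin n) ℂ) a b = 0 := by linear_combination hab
      simpa [sub_eq_zero, Ne.symm hdd] using this
  refine ⟨(LinearEquiv.ofInjectiveEndo (T : SkewHermitian n →ₗ[ℝ] SkewHermitian n)
    hinj).toContinuousLinearEquiv, ?_⟩
  exact hT.congr_fderiv (by ext; rfl)

/-- The invariants of a skew-Hermitian block-diagonal perturbation of `diagonal d`. -/
theorem exists_pos_invariants_blockParam {n : ℕ} {U : Matrix (Fin n) (Fin n) ℂ}
    (hU : U ∈ Matrix.unitaryGroup (Fin n) ℂ) {d : Fin n → ℂ}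
    (hd : Matrix.diagonal d ∈ SkewHermitian n) :
    ∃ ε > 0, ∀ X : SkewHermitian n, ‖(X : Matrix (Fin n) (Fin n) ℂ) - offBlock d X‖ < ε →
      (Finset.univ.image d).card ≤
          eigenvalueCount (blockParam U d X : Matrix (Fin n) (Fin n) ℂ) ∧
        ((X : Matrix (Fin n) (Fin n) ℂ) ∈ scalarBlockSubmodule d ↔
          eigenvalueCount (blockParam U d X : Matrix (Fin n) (Fin n) ℂ) =
            (Finset.univ.image d).card) ∧
        ((X : Matrix (Fin n) (Fin n) ℂ) ∈ scalarBlockSubmodule d →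
          sumSqMult (blockParam U d X : Matrix (Fin n) (Fin n) ℂ) =
            (Finset.univ.filter fun p : Fin n × Fin n => d p.1 = d p.2).card) := by
  obtain ⟨ε, hε, hloc⟩ := exists_pos_eigenvalueCount_of_commute d
  refine ⟨ε, hε, fun X hXN => ?_⟩
  obtain ⟨G, hG, hyG⟩ := exists_unitary_coe_blockParam hU hd X
  set C : SkewHermitian n := ⟨Matrix.diagonal d, hd⟩ + (X - offBlock d X) with hC
  have hCv : (C : Matrix (Fin n) (Fin n) ℂ) =
    Matrix.diagonal d + ((X : Matrix (Fin n) (Fin n) ℂ) - offBlock d X) := rfl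
  rw [← hCv] at hyG
  obtain ⟨hk, hq⟩ := eigenvalueCount_sumSqMult_unitary_conj hG C
  rw [hyG, hk, hq]
  obtain ⟨V, hV, m, hm⟩ := exists_eq_unitary_conj_diagonal_of_skewHermitian C
  obtain ⟨hle, heq⟩ := hloc C (by rw [hCv, add_sub_cancel_left]; exact hXN)
    (by rw [hCv]; exact (Commute.refl _).add_left (commute_sub_offBlock_diagonal d X))
    (by rw [hm]; exact iSup_eigenspace_unitary_conj_diagonal hV _)
    (by rw [hm, setOf_geomMult_ne_zero_unitary_conj_diagonal hV]; exact Finset.finite_toSet _)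
  have hW : (X : Matrix (Fin n) (Fin n) ℂ) ∈ scalarBlockSubmodule d ↔
      ∃ g : ℂ → ℂ, (C : Matrix (Fin n) (Fin n) ℂ) = Matrix.diagonal (g ∘ d) :=
    mem_scalarBlockSubmodule_iff d X
  have hdiag : ∀ g : ℂ → ℂ, (C : Matrix (Fin n) (Fin n) ℂ) = Matrix.diagonal (g ∘ d) →
      eigenvalueCount (C : Matrix (Fin n) (Fin n) ℂ) = (Finset.univ.image d).card ∧
      sumSqMult (C : Matrix (Fin n) (Fin n) ℂ) =
        (Finset.univ.filter fun p : Fin n × Fin n => d p.1 = d p.2).card := by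
    intro g hg
    have hg' : (C : Matrix (Fin n) (Fin n) ℂ) = 1 * Matrix.diagonal (g ∘ d) * star 1 := by
      simpa using hg
    rw [hg', eigenvalueCount_unitary_conj_diagonal (one_mem _), ← Finset.image_image] at hle ⊢
    rw [sumSqMult_unitary_conj_diagonal (one_mem _)]
    -- The lower bound on the count forces `g` to be injective on the values of `d`, so all
    -- multiplicities are kept.
    have hk' := le_antisymm Finset.card_image_le hle
    refine ⟨hk', ?_⟩
    have hinj := Finset.card_image_iff.1 hk'
    congr 1
    ext p
    simp only [Finset.mem_filter, Finset.mem_univ, true_and, Function.comp_apply]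
    exact ⟨fun h => hinj (by simp) (by simp) h, fun h => by rw [h]⟩
  refine ⟨hle, ?_, ?_⟩
  · rw [hW]
    exact ⟨fun ⟨g, hg⟩ => (hdiag g hg).1, heq⟩
  · rw [hW]
    exact fun ⟨g, hg⟩ => (hdiag g hg).2

/-! ### Flattening charts and strata -/

/-- Around every skew-Hermitian matrix the number of distinct eigenvalues is locally minimal, and
a smooth chart flattens the set where it does not change. -/
theorem exists_chart_eigenvalueCount {n : ℕ} (x : SkewHermitian n) :
    ∃ (φ : OpenPartialHomeomorph (SkewHermitian n) (SkewHermitian n))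
      (W : Submodule ℝ (SkewHermitian n)),
      x ∈ φ.source ∧ ContDiffOn ℝ ∞ φ φ.source ∧ ContDiffOn ℝ ∞ φ.symm φ.target ∧
      Module.finrank ℝ W + sumSqMult (x : Matrix (Fin n) (Fin n) ℂ) =
        n ^ 2 + eigenvalueCount (x : Matrix (Fin n) (Fin n) ℂ) ∧
      ∀ y ∈ φ.source,
        eigenvalueCount (x : Matrix (Fin n) (Fin n) ℂ) ≤
          eigenvalueCount (y : Matrix (Fin n) (Fin n) ℂ) ∧
        (φ y ∈ W ↔ eigenvalueCount (y : Matrix (Fin n) (Fin n) ℂ) =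
          eigenvalueCount (x : Matrix (Fin n) (Fin n) ℂ)) ∧
        (φ y ∈ W → sumSqMult (y : Matrix (Fin n) (Fin n) ℂ) =
          sumSqMult (x : Matrix (Fin n) (Fin n) ℂ)) := by
  obtain ⟨U, hU, l, hx⟩ := exists_eq_unitary_conj_diagonal_of_skewHermitian x
  set d : Fin n → ℂ := fun j => (l j : ℂ) * Complex.I
  have hd : Matrix.diagonal d ∈ SkewHermitian n := by
    simpa using unitary_conj_diagonal_mul_I_mem (U := 1) l
  obtain ⟨ε, hε, hloc⟩ := exists_pos_invariants_blockParam hU hd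
  obtain ⟨e, he⟩ := exists_hasFDerivAt_blockParam hU hd
  have hN : {X : SkewHermitian n | ‖(X : Matrix (Fin n) (Fin n) ℂ) - offBlock d X‖ < ε} ∈
      nhds (0 : SkewHermitian n) := by
    have hc : Continuous fun X : SkewHermitian n =>
        ‖(X : Matrix (Fin n) (Fin n) ℂ) - offBlock d X‖ :=
      (continuous_subtype_val.sub
        (continuous_subtype_val.comp (offBlock d).toContinuousLinearMap.continuous)).norm
    exact (isOpen_lt hc continuous_const).mem_nhds (by simpa using hε)
  obtain ⟨φ, hφx, hφ1, hφ2, hφ⟩ :=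
    exists_smooth_chart_of_hasFDerivAt_equiv (contDiff_blockParam U d) he hN
  have h0 : blockParam U d 0 = x := by
    apply Subtype.ext
    have hd' : star (Matrix.diagonal d) = -Matrix.diagonal d := hd
    rw [hx, ← coe_conjSkewPart_of_mem U hd', blockParam]
    simp
  rw [h0] at hφx
  rw [hx, eigenvalueCount_unitary_conj_diagonal hU, sumSqMult_unitary_conj_diagonal hU]
  refine ⟨φ, ((scalarBlockSubmodule d).restrictScalars ℝ).comap (SkewHermitian n).subtype,
    hφx, hφ1, hφ2, ?_, fun y hy => ?_⟩
  · rw [finrank_skewAdjoint_of_star_mem, finrank_scalarBlockSubmodule]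
    rintro X ⟨h1, h2⟩
    refine ⟨fun a b h h' => ?_, fun a b h => ?_⟩
    · rw [Matrix.star_apply, h1 b a h.symm h'.symm, star_zero]
    · rw [Matrix.star_apply, Matrix.star_apply, h2 a b h]
  · obtain ⟨hXN, hXy⟩ := hφ y hy
    have h := hloc (φ y) hXN
    rw [hXy] at h
    exact h
end

/-- The common level sets of the two invariants are submanifolds. -/
theorem isSubmanifoldOfCodim_level {n k q c : ℕ} (hqk : q = k + c) (M : Set (SkewHermitian n))
    (hM : ∀ A, A ∈ M ↔ eigenvalueCount (A : Matrix (Fin n) (Fin n) ℂ) = k ∧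
      sumSqMult (A : Matrix (Fin n) (Fin n) ℂ) = q) (hne : M.Nonempty) :
    IsSubmanifoldOfCodim c M := by
  have hdim : ∀ x ∈ M, ∃ (φ : OpenPartialHomeomorph (SkewHermitian n) (SkewHermitian n))
      (W : Submodule ℝ (SkewHermitian n)),
      x ∈ φ.source ∧ ContDiffOn ℝ ∞ φ φ.source ∧ ContDiffOn ℝ ∞ φ.symm φ.target ∧
      Module.finrank ℝ W + c = n ^ 2 ∧ ∀ y ∈ φ.source, (y ∈ M ↔ φ y ∈ W) := by
    intro x hx
    obtain ⟨hxk, hxq⟩ := (hM x).1 hx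
    obtain ⟨φ, W, h1, h2, h3, h4, h5⟩ := exists_chart_eigenvalueCount x
    refine ⟨φ, W, h1, h2, h3, by omega, fun y hy => ?_⟩
    obtain ⟨-, h6, h7⟩ := h5 y hy
    rw [hM, ← hxk, ← hxq]
    exact ⟨fun h => h6.2 h.1, fun h => ⟨h6.1 h, h7 h⟩⟩
  refine ⟨hne, n ^ 2 - c, fun x hx => ?_, ?_⟩
  · obtain ⟨φ, W, h1, h2, h3, h4, h5⟩ := hdim x hx
    exact ⟨φ, W, h1, h2, h3, by omega, h5⟩
  · obtain ⟨x, hx⟩ := hne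
    obtain ⟨φ, W, h1, h2, h3, h4, h5⟩ := hdim x hx
    rw [finrank_skewHermitian]
    omega

/-- Having at least `k` distinct eigenvalues is an open condition. -/
theorem isOpen_setOf_le_eigenvalueCount (n k : ℕ) :
    IsOpen {A : SkewHermitian n | k ≤ eigenvalueCount (A : Matrix (Fin n) (Fin n) ℂ)} := by
  rw [isOpen_iff_mem_nhds]
  intro x hx
  obtain ⟨φ, W, h1, -, -, -, h5⟩ := exists_chart_eigenvalueCount x
  exact Filter.mem_of_superset (φ.open_source.mem_nhds h1) fun y hy => le_trans hx (h5 y hy).1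

theorem exists_sumSqMult_eq {n : ℕ} (A : SkewHermitian n) :
    (eigenvalueCount (A : Matrix (Fin n) (Fin n) ℂ) + 1 = n →
      sumSqMult (A : Matrix (Fin n) (Fin n) ℂ) =
        eigenvalueCount (A : Matrix (Fin n) (Fin n) ℂ) + 3) ∧
    eigenvalueCount (A : Matrix (Fin n) (Fin n) ℂ) +
      3 * (n - eigenvalueCount (A : Matrix (Fin n) (Fin n) ℂ)) ≤
        sumSqMult (A : Matrix (Fin n) (Fin n) ℂ) ∧
    sumSqMult (A : Matrix (Fin n) (Fin n) ℂ) ≤ n ^ 2 := by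
  obtain ⟨U, hU, l, h⟩ := exists_eq_unitary_conj_diagonal_of_skewHermitian A
  rw [h, eigenvalueCount_unitary_conj_diagonal hU, sumSqMult_unitary_conj_diagonal hU]
  refine ⟨card_filter_pairs_of_card_image_succ, card_image_add_three_mul_le _, ?_⟩
  simpa [sq] using Finset.card_filter_le (Finset.univ : Finset (Fin n × Fin n))
    (fun p => (l p.1 : ℂ) * Complex.I = (l p.2 : ℂ) * Complex.I)

/-! ### Density of the main stratum -/

theorem derogatorySkewHermitian_subset_closure (n : ℕ) :
    derogatorySkewHermitian n ⊆ closure (oneDoubleSkewHermitian n) := by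
  intro A hA
  obtain ⟨U, hU, l, h⟩ := exists_eq_unitary_conj_diagonal_of_skewHermitian A
  rw [mem_derogatorySkewHermitian_iff, h, eigenvalueCount_unitary_conj_diagonal hU] at hA
  obtain ⟨a, b, hab, hlab⟩ : ∃ a b, a ≠ b ∧ l a = l b := by
    by_contra! hcon
    have : Function.Injective fun j => (l j : ℂ) * Complex.I := fun i j hij => by
      by_contra hne
      exact hcon i j hne (by simpa using hij)
    rw [Finset.card_image_of_injective _ this] at hA
    simp at hA
  -- The weights are distinct except that `b` borrows that of `a`, so moving along `e` keeps the
  -- pair `a`, `b` together.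
  let e : Fin n → ℝ := fun j => if j = b then (a : ℕ) else (j : ℕ)
  have he : ∀ i j, i ≠ b → j ≠ b → e i = e j → i = j := fun i j hi hj hij => by
    simp only [e, hi, hj, if_false] at hij
    exact Fin.ext (by exact_mod_cast hij)
  let D : ℝ → Fin n → ℝ := fun t j => l j + t * e j
  have hDab : ∀ t, D t b = D t a := fun t => by simp [D, e, hab, hlab]
  -- Each other pair collides for at most one `t`: only at `t = 0` if its eigenvalues agree
  -- initially, otherwise possibly at one nonzero `t`.
  have hD : ∀ᶠ t in nhdsWithin (0 : ℝ) {0}ᶜ, ∀ i j, i ≠ b → j ≠ b → D t i = D t j → i = j := by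
    rw [Filter.eventually_all]; intro i
    rw [Filter.eventually_all]; intro j
    by_cases hij : i = j
    · simp [hij]
    by_cases hi : i = b
    · simp [hi]
    by_cases hj : j = b
    · simp [hj]
    have hne : e j - e i ≠ 0 := fun h0 => hij (he i j hi hj (by linarith))
    by_cases hl : l i = l j
    · filter_upwards [self_mem_nhdsWithin] with t ht _ _ hDt
      simp only [D, hl] at hDt
      exact absurd (mul_left_cancel₀ ht (by linarith : t * e i = t * e j)) fun h0 =>
        hij (he i j hi hj h0)
    · have h1 : (l i - l j) / (e j - e i) ≠ 0 := div_ne_zero (sub_ne_zero.2 hl) hne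
      filter_upwards [nhdsWithin_le_nhds (isOpen_ne.mem_nhds h1.symm)] with t ht _ _ hDt
      refine absurd ?_ ht
      rw [eq_div_iff hne]
      simp only [D] at hDt
      linarith
  let γ : ℝ → SkewHermitian n := fun t =>
    ⟨U * Matrix.diagonal (fun j => (D t j : ℂ) * Complex.I) * star U,
      unitary_conj_diagonal_mul_I_mem (D t)⟩
  have hγ : Continuous γ := by
    refine Continuous.subtype_mk ?_ _
    refine (continuous_const.matrix_mul (Continuous.matrix_diagonal ?_)).matrix_mul
      continuous_const
    fun_prop
  have hγ0 : γ 0 = A := by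
    apply Subtype.ext
    rw [h]
    simp [γ, D]
  have hmem : ∀ᶠ t in nhdsWithin (0 : ℝ) {0}ᶜ, γ t ∈ oneDoubleSkewHermitian n := by
    filter_upwards [hD] with t ht
    rw [mem_oneDoubleSkewHermitian_iff]
    show eigenvalueCount (U * Matrix.diagonal (fun j => (D t j : ℂ) * Complex.I) * star U) + 1 = n
    rw [eigenvalueCount_unitary_conj_diagonal hU]
    have himg : Finset.univ.image (fun j => (D t j : ℂ) * Complex.I) =
        (Finset.univ.erase b).image fun j => (D t j : ℂ) * Complex.I := by
      ext μ
      simp only [Finset.mem_image, Finset.mem_univ, true_and, Finset.mem_erase, and_true]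
      constructor
      · rintro ⟨j, rfl⟩
        by_cases hj : j = b
        · exact ⟨a, hab, by rw [hj, hDab]⟩
        · exact ⟨j, hj, rfl⟩
      · rintro ⟨j, -, rfl⟩
        exact ⟨j, rfl⟩
    rw [himg, Finset.card_image_of_injOn, Finset.card_erase_of_mem (Finset.mem_univ _),
      Finset.card_univ, Fintype.card_fin]
    · have := b.pos
      omega
    · intro i hi j hj hij
      exact ht i j (Finset.ne_of_mem_erase hi) (Finset.ne_of_mem_erase hj) (by simpa using hij)
  have hlim : Filter.Tendsto γ (nhdsWithin (0 : ℝ) {0}ᶜ) (nhds A) := by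
    rw [← hγ0]
    exact hγ.continuousAt.tendsto.mono_left nhdsWithin_le_nhds
  exact mem_closure_of_tendsto hlim hmem

/-! ### The stratification theorem -/

theorem zero_mem_derogatorySkewHermitian {n : ℕ} (hn : 2 ≤ n) :
    (0 : SkewHermitian n) ∈ derogatorySkewHermitian n := by
  refine ⟨0, ?_⟩
  have h := geomMult_unitary_conj_diagonal (one_mem (Matrix.unitaryGroup (Fin n) ℂ)) 0 0
  simp only [Matrix.diagonal_zero', mul_zero, zero_mul, Pi.zero_apply, Finset.filter_true,
    Finset.card_univ, Fintype.card_fin] at h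
  show 1 < geomMult 0 0
  omega

theorem mainTheorem7 (n : ℕ) (hn : 2 ≤ n) :
    Module.finrank ℝ (SkewHermitian n) = n ^ 2 ∧
    IsSubmanifoldOfCodim 3 (oneDoubleSkewHermitian n) ∧
    (∃ U : Set (SkewHermitian n), IsOpen U ∧
      oneDoubleSkewHermitian n = derogatorySkewHermitian n ∩ U) ∧
    derogatorySkewHermitian n ⊆ closure (oneDoubleSkewHermitian n) ∧
    (∃ (k : ℕ) (S : Fin k → Set (SkewHermitian n)),
      derogatorySkewHermitian n \ oneDoubleSkewHermitian n = ⋃ i, S i ∧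
      Pairwise (Function.onFun Disjoint S) ∧
      ∀ i, ∃ c : ℕ, 3 < c ∧ IsSubmanifoldOfCodim c (S i)) := by
  refine ⟨finrank_skewHermitian n, ?_, ?_, derogatorySkewHermitian_subset_closure n, ?_⟩
  · refine isSubmanifoldOfCodim_level (k := n - 1) (q := n - 1 + 3) rfl _ (fun A => ?_) ?_
    · rw [mem_oneDoubleSkewHermitian_iff]
      have h := (exists_sumSqMult_eq A).1
      omega
    · exact closure_nonempty_iff.1
        ⟨0, derogatorySkewHermitian_subset_closure n (zero_mem_derogatorySkewHermitian hn)⟩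
  · refine ⟨_, isOpen_setOf_le_eigenvalueCount n (n - 1), Set.ext fun A => ?_⟩
    show _ ↔ _ ∧ n - 1 ≤ _
    rw [mem_oneDoubleSkewHermitian_iff, mem_derogatorySkewHermitian_iff]
    omega
  · have hmem : ∀ A : SkewHermitian n, A ∈ derogatorySkewHermitian n \ oneDoubleSkewHermitian n ↔
        eigenvalueCount (A : Matrix (Fin n) (Fin n) ℂ) + 2 ≤ n := fun A => by
      rw [Set.mem_sdiff, mem_oneDoubleSkewHermitian_iff, mem_derogatorySkewHermitian_iff]
      omega
    let I : SkewHermitian n → ℕ × ℕ := fun A =>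
      (eigenvalueCount (A : Matrix (Fin n) (Fin n) ℂ), sumSqMult (A : Matrix (Fin n) (Fin n) ℂ))
    have hfin : (I '' (derogatorySkewHermitian n \ oneDoubleSkewHermitian n)).Finite := by
      refine ((Set.finite_Iic n).prod (Set.finite_Iic (n ^ 2))).subset ?_
      rintro _ ⟨A, hA, rfl⟩
      have h1 := (hmem A).1 hA
      exact ⟨by show eigenvalueCount _ ≤ n; omega, (exists_sumSqMult_eq A).2.2⟩
    let s := hfin.toFinset.equivFin.symm
    have hs : ∀ A ∈ derogatorySkewHermitian n \ oneDoubleSkewHermitian n, ∃ i, I A = s i := by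
      intro A hA
      exact ⟨s.symm ⟨I A, hfin.mem_toFinset.2 ⟨A, hA, rfl⟩⟩, by simp⟩
    have hs' : ∀ i, ∃ A ∈ derogatorySkewHermitian n \ oneDoubleSkewHermitian n, I A = s i :=
      fun i => hfin.mem_toFinset.1 (s i).2
    refine ⟨_, fun i => {A | I A = s i}, Set.ext fun A => ?_, fun i j hij => ?_, fun i => ?_⟩
    · rw [Set.mem_iUnion]
      refine ⟨hs A, fun ⟨i, hi⟩ => ?_⟩
      obtain ⟨B, hB, hBi⟩ := hs' i
      rw [hmem] at hB ⊢
      have : I A = I B := (show I A = s i from hi).trans hBi.symm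
      have h1 : eigenvalueCount (A : Matrix (Fin n) (Fin n) ℂ) = eigenvalueCount B.1 :=
        congrArg Prod.fst this
      omega
    · refine Set.disjoint_left.2 fun A hi hj => hij (s.injective (Subtype.ext ?_))
      exact (show I A = s i from hi).symm.trans hj
    · obtain ⟨B, hB, hBi⟩ := hs' i
      have hB' := (hmem B).1 hB
      have h3 := (exists_sumSqMult_eq B).2.1
      -- The codimension exceeds 3 since it is at least `3 (n - k)` with `k ≤ n - 2`.
      refine ⟨sumSqMult B.1 - eigenvalueCount B.1, by omega,
        isSubmanifoldOfCodim_level (k := eigenvalueCount B.1) (q := sumSqMult B.1) (by omega) _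
          (fun A => ?_) ⟨B, hBi⟩⟩
      show I A = s i ↔ _
      rw [← hBi]
      exact Prod.ext_iff
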